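/- Let $k$ be an algebraically closed field of characteristic zero. Let $H$ be a diagonalizable algebraic group over $k$, i.e. an algebraic group isomorphic to $\operatorname{Spec} k[M]$ for some finitely generated abelian group $M$ (equivalently, to a finite product of copies of $\mathbb{G}_m$ and of finite cyclic groups $\mu_n$). Let $Z$ and $X$ be complete irreducible $H$-varieties over $k$, i.e. integral proper $k$-schemes equipped with an algebraic action of $H$, and let $\alpha\colon Z\to X$ be an $H$-equivariant birational morphism over $k$. Let $x\in X$ be a (closed) point which is fixed by $H$ and at which $X$ is smooth, i.e. $\mathcal{O}_{X,x}$ is a regular local ring. Then there exists an $H$-fixed (closed) point $z\in Z$ such that $\alpha(z)=x$. -/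

import Mathlib

open CategoryTheory MonoidalCategory CartesianMonoidalCategory AlgebraicGeometry
open scoped MonObj

universe u

namespace EquivariantVariety

/-- The base scheme `Spec k` of a field `k`. -/
noncomputable abbrev base (k : Type u) [Field k] : Scheme.{u} := Spec (CommRingCat.of k)

/-- The diagonalizable group scheme `Spec k[M]` with character group `M`, as a scheme over `k`.
Mathlib equips it with the group structure that is dual to the Hopf algebra structure of the
group algebra `k[M]` (every element of `M` is group-like). -/
noncomputable abbrev diagonalizableModel (k : Type u) [Field k] (M : Type u) [CommGroup M] :
    Over (base k) :=
  (Spec (CommRingCat.of (MonoidAlgebra k M))).asOver (base k)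

/-- A group scheme `H` over `k` is a diagonalizable (algebraic) group if it is isomorphic, as a
group scheme, to `Spec k[M]` for a finitely generated abelian group `M`; equivalently, it is a
finite product of groups `𝔾ₘ` and `μₙ`. -/
def IsDiagonalizable {k : Type u} [Field k] (H : Over (base k)) [GrpObj H] : Prop :=
  ∃ (M : Type u) (_ : CommGroup M) (_ : Group.FG M) (e : H ≅ diagonalizableModel k M),
    IsMonHom e.hom

/-- A complete irreducible variety over `k` (the field is algebraically closed in all uses): an
integral scheme that is proper over `k` (in particular separated and of finite type). -/
structure IsCompleteVariety {k : Type u} [Field k] (X : Over (base k)) : Prop where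
  integral : IsIntegral X.left
  proper : IsProper X.hom

/-- The (closed) points of a variety over an algebraically closed field `k`, as `k`-rational
points, i.e. morphisms `Spec k ⟶ X` over `k`. -/
abbrev Point {k : Type u} [Field k] (X : Over (base k)) : Type u := 𝟙_ (Over (base k)) ⟶ X

/-- The point of the underlying topological space of `X` that belongs to a `k`-point. -/
noncomputable def Point.toSpace {k : Type u} [Field k] {X : Over (base k)} (x : Point X) :
    X.left :=
  (show Spec (CommRingCat.of k) ⟶ X.left from x.left) (IsLocalRing.closedPoint k)

/-- A point is smooth (nonsingular) if its local ring is a regular local ring. -/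
def IsSmoothPoint {k : Type u} [Field k] {X : Over (base k)} (x : Point X) : Prop :=
  IsRegularLocalRing (X.left.presheaf.stalk x.toSpace)

/-- The translate `h • x` of a point `x` by an element `h` of the group. -/
noncomputable def Point.act {k : Type u} [Field k] {H X : Over (base k)} [GrpObj H] [ModObj H X]
    (h : Point H) (x : Point X) : Point X :=
  lift h x ≫ γ[H, X]

/-- `x` is an `H`-fixed point if `h • x = x` for all elements `h` of the group `H`. -/
def IsFixedPoint {k : Type u} [Field k] (H : Over (base k)) {X : Over (base k)} [GrpObj H]
    [ModObj H X] (x : Point X) : Prop :=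
  ∀ h : Point H, Point.act h x = x

/-- A morphism is birational if it restricts to an isomorphism from a dense open subscheme of the
source onto a dense open subscheme of the target. -/
def IsBirationalMorphism {Z X : Scheme.{u}} (f : Z ⟶ X) : Prop :=
  ∃ p : Z.PartialIso X, p.iso.hom ≫ p.target.ι = p.source.ι ≫ f

end EquivariantVariety

namespace EquivariantVariety

open IsLocalRing Module

/-! The point `x` is blown up to an `H`-invariant valuation, and the valuative criterion carries its
centre to `Z`.

The group `H(k)` is commutative and acts on the regular local ring `R` of `X` at `x`, hence on the
cotangent space `m/m²`, where the action can be triangularized. Lift a triangularizing basis to a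
regular system of parameters. Their monomials, in graded lexicographic order, filter `R`; the order
is such that each group element multiplies a monomial by a unit modulo later ones
(`exists_triangular_parameters`). Parameters of a regular local ring are quasi-regular
(`coeff_mem_maximalIdeal_of_eval_mem`), so leading exponents add under multiplication. They define a
valuation of `K = Frac R` whose ring `V` dominates `R`, has residue field `k` and is stable under
the group (`exists_invariant_valuationSubring`).

Since `f` is birational, `Spec K ⟶ X` lifts to `Z`; since `f` is proper, so does `Spec V ⟶ X`,
uniquely. Uniqueness makes the lift equivariant. The group acts trivially on the residue field of
`V`, so the resulting `k`-point of `Z` is fixed, and it lies over `x`. -/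

/-! ### Quasi-regularity of a regular system of parameters. -/

lemma exists_isPrime_le_ringKrullDim_quotient {R : Type*} [CommRing R] {n : ℕ}
    (h : (n : WithBot ℕ∞) ≤ ringKrullDim R) :
    ∃ Q : Ideal R, Q.IsPrime ∧ (n : WithBot ℕ∞) ≤ ringKrullDim (R ⧸ Q) := by
  obtain ⟨l, hl⟩ := Order.le_krullDim_iff.mp h
  refine ⟨l.head.asIdeal, l.head.isPrime, ?_⟩
  rw [ringKrullDim_quotient, Order.le_krullDim_iff]
  refine ⟨⟨l.length, fun i ↦ ⟨l i, ?_⟩, fun i ↦ l.step i⟩, hl⟩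
  exact l.head_le i

lemma eval_mem_of_coeff_mem {R : Type*} [CommRing R] {n d : ℕ} {I J : Ideal R}
    (x : Fin n → R) (hx : ∀ i, x i ∈ J) (F : MvPolynomial (Fin n) R)
    (hF : F.IsHomogeneous d) (hc : ∀ a, F.coeff a ∈ I) :
    MvPolynomial.eval x F ∈ I * J ^ d := by
  rw [MvPolynomial.eval_eq]
  refine Ideal.sum_mem _ fun a ha ↦ Ideal.mul_mem_mul (hc a) ?_
  have : ∑ i, a i = d := by
    rw [← hF (MvPolynomial.mem_support_iff.mp ha), Finsupp.weight_apply]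
    simp [Finsupp.sum_fintype]
  have hprod : ∏ i ∈ a.support, x i ^ a i = ∏ i, x i ^ a i :=
    Finset.prod_subset (Finset.subset_univ _) fun i _ hi ↦ by
      rw [Finsupp.notMem_support_iff.mp hi, pow_zero]
  rw [← this, ← Finset.prod_pow_eq_pow_sum, hprod]
  exact Ideal.prod_mem_prod fun i _ ↦ Ideal.pow_mem_pow (hx i) _

/-- The substitution `X 0 ↦ 0` on polynomials. -/
noncomputable def dropZero {R S : Type*} [CommRing R] [CommRing S] (q : R →+* S) (n : ℕ) :
    MvPolynomial (Fin (n + 1)) R →+* MvPolynomial (Fin n) S :=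
  MvPolynomial.eval₂Hom (MvPolynomial.C.comp q) (Fin.cons 0 MvPolynomial.X)

lemma eval_dropZero {R S : Type*} [CommRing R] [CommRing S] (q : R →+* S) {n : ℕ}
    (x : Fin (n + 1) → R) (hx : q (x 0) = 0) (F : MvPolynomial (Fin (n + 1)) R) :
    MvPolynomial.eval (fun i ↦ q (x i.succ)) (dropZero q n F) = q (MvPolynomial.eval x F) := by
  have : (MvPolynomial.eval (fun i ↦ q (x (Fin.succ i)))).comp (dropZero q n)
      = q.comp (MvPolynomial.eval x) := by
    ext i
    · simp [dropZero]
    · refine Fin.cases ?_ (fun j ↦ ?_) i <;> simp [dropZero, hx]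
  exact DFunLike.congr_fun this F

lemma isHomogeneous_dropZero {R S : Type*} [CommRing R] [CommRing S] (q : R →+* S) {n d : ℕ}
    {F : MvPolynomial (Fin (n + 1)) R} (hF : F.IsHomogeneous d) :
    (dropZero q n F).IsHomogeneous d := by
  have := hF.eval₂ (MvPolynomial.C.comp q)
    (Fin.cons 0 MvPolynomial.X : Fin (n + 1) → MvPolynomial (Fin n) S) (n := 1)
    (fun r ↦ MvPolynomial.isHomogeneous_C _ _) (fun i ↦ ?_)
  · rw [one_mul] at this
    exact this
  · refine Fin.cases ?_ (fun j ↦ ?_) i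
    · simpa using MvPolynomial.isHomogeneous_zero _ _ _
    · simpa using MvPolynomial.isHomogeneous_X _ _

lemma coeff_dropZero {R S : Type*} [CommRing R] [CommRing S] (q : R →+* S) {n : ℕ}
    (F : MvPolynomial (Fin (n + 1)) R) (b : Fin n →₀ ℕ) :
    (dropZero q n F).coeff b = q (F.coeff (b.cons 0)) := by
  classical
  induction F using MvPolynomial.induction_on' with
  | monomial a c =>
    have : dropZero q n (MvPolynomial.monomial a c) =
        if a 0 = 0 then MvPolynomial.monomial a.tail (q c) else 0 := by
      rw [dropZero, MvPolynomial.coe_eval₂Hom, MvPolynomial.eval₂_monomial,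
        Finsupp.prod_fintype _ _ (by simp), Fin.prod_univ_succ, MvPolynomial.monomial_eq,
        Finsupp.prod_fintype _ _ (by simp)]
      split_ifs with h <;> simp [h, Finsupp.tail_apply]
    rw [this, MvPolynomial.coeff_monomial]
    by_cases h : a 0 = 0
    · rw [if_pos h, MvPolynomial.coeff_monomial]
      have : a.tail = b ↔ a = b.cons 0 := by
        constructor
        · rintro rfl; rw [← h, Finsupp.cons_tail]
        · rintro rfl; simp
      simp [this, apply_ite q]
    · have : a ≠ b.cons 0 := by rintro rfl; simp at h
      simp [h, this]
  | add p r hp hr => simp [hp, hr]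

lemma comap_maximalIdeal_of_surjective {R S : Type*} [CommRing R] [CommRing S] [IsLocalRing R]
    [IsLocalRing S] (q : R →+* S) (hq : Function.Surjective q) :
    (maximalIdeal S).comap q = maximalIdeal R :=
  have : IsLocalHom q := hq.isLocalHom
  ((local_hom_TFAE q).out 0 4).mp this

lemma map_maximalIdeal_of_surjective {R S : Type*} [CommRing R] [CommRing S] [IsLocalRing R]
    [IsLocalRing S] (q : R →+* S) (hq : Function.Surjective q) :
    (maximalIdeal R).map q = maximalIdeal S := by
  rw [← comap_maximalIdeal_of_surjective q hq, Ideal.map_comap_of_surjective q hq]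

/-- Ideals of a Noetherian local ring are closed in the adic topology. -/
lemma mem_of_forall_mem_sup_pow {R : Type*} [CommRing R] [IsLocalRing R] [IsNoetherianRing R]
    {I : Ideal R} {y : R} (h : ∀ N, y ∈ I ⊔ maximalIdeal R ^ N) : y ∈ I := by
  rw [← Ideal.Quotient.eq_zero_iff_mem]
  have := Ideal.iInf_pow_smul_eq_bot_of_isLocalRing (M := R ⧸ I) (maximalIdeal R)
    (maximalIdeal.isMaximal R).ne_top
  rw [← Submodule.mem_bot R, ← this, Submodule.mem_iInf]
  intro N
  obtain ⟨a, ha, b, hb, rfl⟩ := Submodule.mem_sup.mp (h N)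
  rw [map_add, Ideal.Quotient.eq_zero_iff_mem.mpr ha, zero_add]
  have : Ideal.Quotient.mk I b = b • (1 : R ⧸ I) := by
    rw [Algebra.smul_def, mul_one]; rfl
  rw [this]
  exact Submodule.smul_mem_smul hb trivial

/-- A system of parameters generating the maximal ideal of a local ring is quasi-regular. -/
theorem coeff_mem_maximalIdeal_of_eval_mem {n : ℕ} : ∀ {R : Type u} [CommRing R] [IsLocalRing R]
    [IsNoetherianRing R] (x : Fin n → R) (_ : Ideal.span (Set.range x) = maximalIdeal R)
    (_ : (n : WithBot ℕ∞) ≤ ringKrullDim R) {d : ℕ} {F : MvPolynomial (Fin n) R}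
    (_ : F.IsHomogeneous d) (_ : MvPolynomial.eval x F ∈ maximalIdeal R ^ (d + 1))
    (a : Fin n →₀ ℕ), F.coeff a ∈ maximalIdeal R := by
  induction n with
  | zero =>
    intro R _ _ _ x hx _ d F hF h a
    obtain rfl : a = 0 := Subsingleton.elim _ _
    have := Ideal.pow_le_self (Nat.succ_ne_zero d) h
    rwa [MvPolynomial.eq_C_of_isEmpty F, MvPolynomial.eval_C] at this
  | succ n ih =>
    intro R _ _ _ x hx hn
    -- `Q` is the bottom of a chain of `n + 1` strict inclusions of primes, so `R ⧸ Q` still has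
    -- dimension at least `n + 1`. A domain is wanted in order to cancel `x 0`.
    obtain ⟨Q, hQ, hnQ⟩ := exists_isPrime_le_ringKrullDim_quotient hn
    -- reduction to a domain
    suffices key : ∀ {R : Type u} [CommRing R] [IsLocalRing R] [IsDomain R]
        [IsNoetherianRing R] (x : Fin (n + 1) → R)
        (_ : Ideal.span (Set.range x) = maximalIdeal R)
        (_ : ((n + 1 : ℕ) : WithBot ℕ∞) ≤ ringKrullDim R) {d : ℕ}
        {F : MvPolynomial (Fin (n + 1)) R}
        (_ : F.IsHomogeneous d) (_ : MvPolynomial.eval x F ∈ maximalIdeal R ^ (d + 1))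
        (a : Fin (n + 1) →₀ ℕ), F.coeff a ∈ maximalIdeal R by
      intro d F hF h a
      have : IsLocalRing (R ⧸ Q) := .of_surjective' _ Ideal.Quotient.mk_surjective
      have hm := map_maximalIdeal_of_surjective (Ideal.Quotient.mk Q) Ideal.Quotient.mk_surjective
      have := key (R := R ⧸ Q) (fun i ↦ Ideal.Quotient.mk Q (x i))
        (by rw [← hm, ← hx, Ideal.map_span, ← Set.range_comp]; rfl) hnQ
        (hF.map (Ideal.Quotient.mk Q))
        (by
          have := Ideal.mem_map_of_mem (Ideal.Quotient.mk Q) h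
          rw [Ideal.map_pow, hm] at this
          convert this using 1
          rw [MvPolynomial.eval_map, MvPolynomial.eval₂_comp]; rfl) a
      rwa [MvPolynomial.coeff_map, ← Ideal.mem_comap,
        comap_maximalIdeal_of_surjective _ Ideal.Quotient.mk_surjective] at this
    clear hx hn hnQ x hQ Q
    intro R _ _ _ _ x hx hn
    have hxm (i) : x i ∈ maximalIdeal R := hx ▸ Ideal.subset_span ⟨i, rfl⟩
    let q := Ideal.Quotient.mk (Ideal.span {x 0})
    have hq0 : q (x 0) = 0 := Ideal.Quotient.eq_zero_iff_mem.mpr (Ideal.mem_span_singleton_self _)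
    have : Nontrivial (R ⧸ Ideal.span {x 0}) :=
      Ideal.Quotient.nontrivial_iff.mpr fun h ↦ (maximalIdeal.isMaximal R).ne_top <|
        top_le_iff.mp <| h ▸ (Ideal.span_singleton_le_iff_mem _).mpr (hxm 0)
    have : IsLocalRing (R ⧸ Ideal.span {x 0}) := .of_surjective' q Ideal.Quotient.mk_surjective
    have hm : (maximalIdeal R).map q = maximalIdeal (R ⧸ Ideal.span {x 0}) :=
      map_maximalIdeal_of_surjective q Ideal.Quotient.mk_surjective
    have hrange : Set.range x = insert (x 0) (Set.range fun i : Fin n ↦ x i.succ) := by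
      rw [← Fin.range_cons]
      exact congrArg Set.range (Fin.cons_self_tail x).symm
    have hx' : Ideal.span (Set.range fun i ↦ q (x (Fin.succ i))) =
        maximalIdeal (R ⧸ Ideal.span {x 0}) := by
      rw [← hm, ← hx, hrange, Ideal.map_span, Set.image_insert_eq, hq0, Ideal.span_insert,
        ← Set.range_comp]
      simp only [Set.singleton_zero, Ideal.span_zero, bot_sup_eq]
      rfl
    have hdim : (n : WithBot ℕ∞) ≤ ringKrullDim (R ⧸ Ideal.span {x 0}) := by
      have := hn.trans (ringKrullDim_le_ringKrullDim_quotient_add_encard {x 0}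
        (by rw [ringJacobson_eq_maximalIdeal]; simpa using hxm 0))
      rw [Set.encard_singleton, Nat.cast_succ] at this
      generalize ringKrullDim (R ⧸ Ideal.span {x 0}) = e at this ⊢
      induction e with
      | bot => simp at this
      | coe e =>
        have h : (n : ℕ∞) + 1 ≤ e + 1 := by exact_mod_cast this
        exact_mod_cast (ENat.add_le_add_iff_right ENat.one_ne_top).mp h
    -- Otherwise `n` elements would generate the maximal ideal of a ring of dimension at least `n +
    -- 1`.
    have hx0 : x 0 ≠ 0 := by
      intro h0
      rw [hrange, h0, Ideal.span_insert] at hx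
      simp only [Set.singleton_zero, Ideal.span_zero, bot_sup_eq] at hx
      have h1 := hn.trans (ringKrullDim_le_spanFinrank_maximalIdeal R)
      have h2 : (maximalIdeal R).spanFinrank ≤ n := by
        rw [← hx]
        exact (Submodule.spanFinrank_span_le_ncard_of_finite (Set.finite_range _)).trans
          (by simpa [Set.image_univ] using
            Set.ncard_image_le (s := Set.univ) (f := fun i : Fin n ↦ x i.succ))
      have h3 : n + 1 ≤ (maximalIdeal R).spanFinrank := by exact_mod_cast h1
      omega
    -- coefficients of the monomials without `X 0`
    have hcoeff {d : ℕ} {F : MvPolynomial (Fin (n + 1)) R} (hF : F.IsHomogeneous d)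
        (h : MvPolynomial.eval x F ∈ maximalIdeal R ^ (d + 1) ⊔ Ideal.span {x 0})
        (b : Fin n →₀ ℕ) : F.coeff (b.cons 0) ∈ maximalIdeal R := by
      have := ih (fun i ↦ q (x (Fin.succ i))) hx' hdim (isHomogeneous_dropZero q hF) (by
        rw [eval_dropZero q x hq0, ← hm, ← Ideal.map_pow]
        have := Ideal.mem_map_of_mem q h
        rwa [Ideal.map_sup, Ideal.map_span, Set.image_singleton, hq0, Set.singleton_zero,
          Ideal.span_zero, sup_bot_eq] at this) b
      rwa [coeff_dropZero, ← Ideal.mem_comap,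
        comap_maximalIdeal_of_surjective q Ideal.Quotient.mk_surjective] at this
    -- `G` is the quotient of `F` by `X 0`. The remainder has coefficients in the maximal ideal by
    -- `hcoeff`, so its value at `x` gains one order.
    have hsplit {d : ℕ} {F : MvPolynomial (Fin (n + 1)) R} (hF : F.IsHomogeneous (d + 1))
        (h : MvPolynomial.eval x F ∈ maximalIdeal R ^ (d + 2) ⊔ Ideal.span {x 0}) :
        ∃ G : MvPolynomial (Fin (n + 1)) R, G.IsHomogeneous d ∧
          (∀ a, F.coeff a ∈ maximalIdeal R ∨ ∃ b, F.coeff a = G.coeff b) ∧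
          MvPolynomial.eval x F - x 0 * MvPolynomial.eval x G ∈ maximalIdeal R ^ (d + 2) := by
      have hle {a : Fin (n + 1) →₀ ℕ} : Finsupp.single 0 1 ≤ a ↔ a 0 ≠ 0 := by
        rw [Finsupp.single_le_iff, Nat.one_le_iff_ne_zero]
      have hzero {a : Fin (n + 1) →₀ ℕ} (ha : a 0 = 0) : F.coeff a ∈ maximalIdeal R := by
        rw [← Finsupp.cons_tail a, ha]
        exact hcoeff hF h _
      refine ⟨F.divMonomial (Finsupp.single 0 1), fun a ha ↦ ?_, fun a ↦ ?_, ?_⟩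
      · rw [MvPolynomial.coeff_divMonomial] at ha
        have := hF ha
        rw [map_add, Finsupp.weight_single] at this
        simp only [Pi.one_apply, smul_eq_mul, mul_one] at this
        omega
      · by_cases ha : a 0 = 0
        · exact .inl (hzero ha)
        · refine .inr ⟨a - Finsupp.single 0 1, ?_⟩
          rw [MvPolynomial.coeff_divMonomial, add_tsub_cancel_of_le (hle.mpr ha)]
      · have hF' := congrArg (MvPolynomial.eval x) (F.divMonomial_add_modMonomial_single 0)
        rw [map_add, map_mul, MvPolynomial.eval_X] at hF'
        rw [sub_eq_iff_eq_add'.mpr hF'.symm, pow_succ']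
        have hmod (a) : (F.modMonomial (Finsupp.single 0 1)).coeff a =
            if a 0 = 0 then F.coeff a else 0 := by
          split_ifs with ha
          · exact MvPolynomial.coeff_modMonomial_of_not_le _ (by simpa [hle] using ha)
          · exact MvPolynomial.coeff_modMonomial_of_le _ (hle.mpr ha)
        refine eval_mem_of_coeff_mem x hxm _ (fun a ha ↦ hF ?_) fun a ↦ ?_
        · rw [hmod] at ha
          exact fun h ↦ ha (by simp [h])
        · rw [hmod]
          split_ifs with ha
          exacts [hzero ha, zero_mem _]
    -- Multiplication by `x 0` raises the order by exactly one. The error term of `hN` is a form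
    -- whose value is divisible by `x 0`, so `hsplit` pushes it one order higher; Krull's
    -- intersection theorem then removes it.
    have hstar {d : ℕ} {g : R} (h : x 0 * g ∈ maximalIdeal R ^ (d + 1)) :
        g ∈ maximalIdeal R ^ d := by
      have hN (N : ℕ) : x 0 * g ∈ Ideal.span {x 0} * maximalIdeal R ^ d ⊔
          maximalIdeal R ^ (d + 1 + N) := by
        induction N with
        | zero => exact Ideal.mem_sup_right h
        | succ N hN =>
          obtain ⟨y, hy, z, hz, hyz⟩ := Submodule.mem_sup.mp hN
          rw [← hx, Ideal.mem_span_pow_iff_exists_isHomogeneous] at hz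
          obtain ⟨F, hF, rfl⟩ := hz
          obtain ⟨y', hy', rfl⟩ := Ideal.mem_span_singleton_mul.mp hy
          obtain ⟨G, hG, -, hFG⟩ := hsplit (d := d + N) (F := F) (by convert hF using 1; ring) (by
            refine Ideal.mem_sup_right (Ideal.mem_span_singleton.mpr ⟨g - y', ?_⟩)
            linear_combination hyz)
          have hG' : MvPolynomial.eval x G ∈ maximalIdeal R ^ (d + N) := by
            rw [← hx, Ideal.mem_span_pow_iff_exists_isHomogeneous]
            exact ⟨G, hG, rfl⟩
          rw [← hyz, show x 0 * y' + MvPolynomial.eval x F =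
            x 0 * (y' + MvPolynomial.eval x G) +
              (MvPolynomial.eval x F - x 0 * MvPolynomial.eval x G) by ring]
          refine Ideal.add_mem _ (Ideal.mem_sup_left ?_) (Ideal.mem_sup_right ?_)
          · exact Ideal.mul_mem_mul (Ideal.mem_span_singleton_self _)
              (Ideal.add_mem _ hy' (Ideal.pow_le_pow_right (by omega) hG'))
          · convert hFG using 2; ring
      have : x 0 * g ∈ Ideal.span {x 0} * maximalIdeal R ^ d :=
        mem_of_forall_mem_sup_pow fun N ↦ by
          have hle : maximalIdeal R ^ (d + 1 + N) ≤ maximalIdeal R ^ N :=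
            Ideal.pow_le_pow_right (Nat.le_add_left N (d + 1))
          exact (sup_le_sup le_rfl hle : _ ≤ Ideal.span {x 0} * maximalIdeal R ^ d ⊔ _) (hN N)
      obtain ⟨y, hy, hyg⟩ := Ideal.mem_span_singleton_mul.mp this
      rwa [← mul_left_cancel₀ hx0 hyg]
    intro d
    induction d with
    | zero =>
      intro F hF h a
      obtain ⟨c, rfl⟩ : ∃ c, F = MvPolynomial.C c :=
        ⟨_, MvPolynomial.totalDegree_eq_zero_iff_eq_C.mp (Nat.le_zero.mp hF.totalDegree_le)⟩
      rw [MvPolynomial.eval_C, zero_add, pow_one] at h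
      rw [MvPolynomial.coeff_C]
      split_ifs
      exacts [h, zero_mem _]
    | succ d ihd =>
      intro F hF h a
      obtain ⟨G, hG, hFG, hsub⟩ := hsplit hF (Ideal.mem_sup_left h)
      obtain h' | ⟨b, hb⟩ := hFG a
      · exact h'
      · rw [hb]
        refine ihd hG (hstar (d := d + 1) ?_) b
        convert Ideal.sub_mem _ h hsub using 1
        ring

/-! ### Simultaneous triangularization. -/

/-- A commuting set of endomorphisms of a nonzero finite-dimensional vector space over an
algebraically closed field has a common eigenvector. -/
lemma exists_common_eigenvector {k V : Type*} [Field k] [IsAlgClosed k] [AddCommGroup V]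
    [Module k V] [FiniteDimensional k V] [Nontrivial V] (S : Set (End k V))
    (hS : ∀ s ∈ S, ∀ t ∈ S, Commute s t) :
    ∃ v : V, v ≠ 0 ∧ ∀ s ∈ S, ∃ c : k, s v = c • v := by
  generalize hn : finrank k V = n
  induction n using Nat.strong_induction_on generalizing V with | _ n ih =>
  by_cases h : ∀ s ∈ S, ∃ c : k, ∀ v, s v = c • v
  · obtain ⟨v, hv⟩ := exists_ne (0 : V)
    exact ⟨v, hv, fun s hs ↦ (h s hs).imp fun c hc ↦ hc v⟩
  push Not at h
  obtain ⟨s, hs, hns⟩ := h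
  -- An eigenspace of the non-scalar `s` is proper, and it is stable under `S` by commutativity, so
  -- the induction on dimension applies to it.
  obtain ⟨c, hc⟩ := End.exists_eigenvalue s
  let W := s.eigenspace c
  have hW (t : S) : Set.MapsTo t.1 W W := End.mapsTo_genEigenspace_of_comm (hS _ hs _ t.2) c 1
  have : Nontrivial W := Submodule.nontrivial_iff_ne_bot.mpr hc
  have hlt : finrank k W < n := by
    rw [← hn]
    refine Submodule.finrank_lt fun h ↦ ?_
    obtain ⟨v, hv⟩ := hns c
    exact hv (End.mem_eigenspace_iff.mp (h ▸ Submodule.mem_top : v ∈ W))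
  obtain ⟨v, hv, hvS⟩ := ih _ hlt (Set.range fun t : S ↦ t.1.restrict (hW t)) (by
    rintro _ ⟨t, rfl⟩ _ ⟨t', rfl⟩
    ext v
    exact DFunLike.congr_fun (hS _ t.2 _ t'.2).eq v.1) rfl
  refine ⟨v, by simpa using hv, fun t ht ↦ ?_⟩
  obtain ⟨c, hc⟩ := hvS _ ⟨⟨t, ht⟩, rfl⟩
  exact ⟨c, congrArg Subtype.val hc⟩

/-- Simultaneous triangularization of a commuting set of automorphisms that is closed under
inverses. -/
lemma exists_triangular_spanning {k V : Type*} [Field k] [IsAlgClosed k] [AddCommGroup V]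
    [Module k V] [FiniteDimensional k V] (S : Set (End k V))
    (hS : ∀ s ∈ S, ∀ t ∈ S, Commute s t) (hinv : ∀ s ∈ S, ∃ t ∈ S, t * s = 1) {n : ℕ} (hn : finrank k V = n) :
    ∃ b : Fin n → V, Submodule.span k (Set.range b) = ⊤ ∧
      ∀ s ∈ S, ∀ i, ∃ c : k, c ≠ 0 ∧
        s (b i) - c • b i ∈ Submodule.span k (b '' Set.Iio i) := by
  induction n generalizing V with
  | zero =>
    have := finrank_zero_iff.mp hn
    exact ⟨Fin.elim0, Subsingleton.elim _ _, fun _ _ i ↦ i.elim0⟩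
  | succ n ih =>
    have : Nontrivial V := nontrivial_of_finrank_pos (R := k) (by omega)
    obtain ⟨v, hv, hvS⟩ := exists_common_eigenvector S hS
    let L := Submodule.span k {v}
    have hL (s : S) : L ≤ L.comap s.1 := by
      obtain ⟨c, hc⟩ := hvS _ s.2
      rw [Submodule.span_singleton_le_iff_mem, Submodule.mem_comap, hc]
      exact L.smul_mem _ (Submodule.mem_span_singleton_self v)
    obtain ⟨b, hb, hbS⟩ := ih (V := V ⧸ L) (Set.range fun s : S ↦ L.mapQ L s.1 (hL s)) (by
      rintro _ ⟨s, rfl⟩ _ ⟨t, rfl⟩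
      ext w
      exact congrArg L.mkQ (DFunLike.congr_fun (hS _ s.2 _ t.2).eq w)) (by
      rintro _ ⟨s, rfl⟩
      obtain ⟨t, ht, hts⟩ := hinv _ s.2
      refine ⟨_, ⟨⟨t, ht⟩, rfl⟩, ?_⟩
      ext w
      exact congrArg L.mkQ (DFunLike.congr_fun hts w)) (by
        have := L.finrank_quotient_add_finrank
        rw [finrank_span_singleton hv] at this
        omega)
    choose b' hb' using fun i ↦ L.mkQ_surjective (b i)
    have hLspan (T : Set V) (hvT : v ∈ T) (w : V)
        (hw : L.mkQ w ∈ Submodule.span k (L.mkQ '' T)) : w ∈ Submodule.span k T := by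
      rw [← Submodule.map_span, ← Submodule.mem_comap, Submodule.comap_map_mkQ] at hw
      have hLT : L ≤ Submodule.span k T :=
        (Submodule.span_singleton_le_iff_mem _ _).mpr (Submodule.subset_span hvT)
      rwa [sup_eq_right.mpr hLT] at hw
    -- With the eigenvector `v` in front, every later initial span contains `L`, so relations modulo
    -- `L` lift to `V`.
    refine ⟨Fin.cons v b', ?_, fun s hs i ↦ ?_⟩
    · rw [eq_top_iff]
      intro w _
      refine hLspan _ (Set.mem_range.mpr ⟨0, rfl⟩) w ?_
      have : Set.range b ⊆ L.mkQ '' Set.range (Fin.cons v b' : Fin (n + 1) → V) := by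
        rintro _ ⟨i, rfl⟩
        exact ⟨b' i, ⟨i.succ, by simp⟩, hb' i⟩
      exact Submodule.span_mono this (hb ▸ Submodule.mem_top)
    · induction i using Fin.cases with
      | zero =>
        obtain ⟨c, hc⟩ := hvS s hs
        refine ⟨c, ?_, by simp [hc]⟩
        rintro rfl
        obtain ⟨t, -, hts⟩ := hinv s hs
        exact hv (by simpa [hc] using (DFunLike.congr_fun hts v).symm)
      | succ i =>
        obtain ⟨c, hc0, hc⟩ := hbS _ ⟨⟨s, hs⟩, rfl⟩ i
        refine ⟨c, hc0, hLspan _ ((Set.mem_image _ _ _).mpr ⟨0, Fin.succ_pos i, rfl⟩) _ ?_⟩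
        have : b '' Set.Iio i ⊆ L.mkQ '' ((Fin.cons v b' : Fin (n + 1) → V) '' Set.Iio i.succ) := by
          rintro _ ⟨j, hj, rfl⟩
          exact ⟨b' j, ⟨j.succ, Fin.succ_lt_succ_iff.mpr hj, by simp⟩, hb' j⟩
        convert Submodule.span_mono this hc using 1
        simp [← hb']

/-! ### The filtration by monomials in graded lexicographic order. -/

section MonomialFiltration

variable {R : Type u} [CommRing R] {n : ℕ} (x : Fin n → R)

/-- The monomial `x ^ a`. -/
def mono (a : DegLex (Fin n →₀ ℕ)) : R := ∏ i, x i ^ ofDegLex a i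

/-- The ideal generated by the monomials `x ^ b` with `a ≤ b` in the graded lexicographic order. -/
def geIdeal (a : DegLex (Fin n →₀ ℕ)) : Ideal R := Ideal.span (mono x '' Set.Ici a)

/-- The ideal generated by the monomials `x ^ b` with `a < b` in the graded lexicographic order. -/
def gtIdeal (a : DegLex (Fin n →₀ ℕ)) : Ideal R := Ideal.span (mono x '' Set.Ioi a)

lemma mono_add (a b : DegLex (Fin n →₀ ℕ)) : mono x (a + b) = mono x a * mono x b := by
  simp [mono, ofDegLex_add, pow_add, Finset.prod_mul_distrib]

lemma mono_zero : mono x 0 = 1 := by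
  simp [mono, show ofDegLex (0 : DegLex (Fin n →₀ ℕ)) = 0 from rfl]

lemma mono_single (i : Fin n) : mono x (toDegLex (Finsupp.single i 1)) = x i := by
  rw [mono, Finset.prod_eq_single i] <;> simp +contextual [eq_comm]

lemma mono_eq_eval (a : Fin n →₀ ℕ) :
    mono x (toDegLex a) = MvPolynomial.eval x (MvPolynomial.monomial a 1) := by
  rw [MvPolynomial.eval_monomial, Finsupp.prod_fintype _ _ (by simp), one_mul]; rfl

variable {x}

lemma mono_mem_geIdeal {a b : DegLex (Fin n →₀ ℕ)} (h : a ≤ b) : mono x b ∈ geIdeal x a :=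
  Ideal.subset_span ⟨b, h, rfl⟩

lemma mono_mem_gtIdeal {a b : DegLex (Fin n →₀ ℕ)} (h : a < b) : mono x b ∈ gtIdeal x a :=
  Ideal.subset_span ⟨b, h, rfl⟩

lemma gtIdeal_le_geIdeal (a : DegLex (Fin n →₀ ℕ)) : gtIdeal x a ≤ geIdeal x a :=
  Ideal.span_mono (Set.image_mono Set.Ioi_subset_Ici_self)

lemma geIdeal_le_gtIdeal {a b : DegLex (Fin n →₀ ℕ)} (h : a < b) : geIdeal x b ≤ gtIdeal x a :=
  Ideal.span_mono (Set.image_mono (Set.Ici_subset_Ioi.mpr h))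

lemma geIdeal_anti {a b : DegLex (Fin n →₀ ℕ)} (h : a ≤ b) : geIdeal x b ≤ geIdeal x a :=
  Ideal.span_mono (Set.image_mono (Set.Ici_subset_Ici.mpr h))

lemma geIdeal_zero : geIdeal x 0 = ⊤ :=
  (Ideal.eq_top_iff_one _).mpr (mono_zero x ▸ mono_mem_geIdeal le_rfl)

lemma mul_mem_geIdeal {a b : DegLex (Fin n →₀ ℕ)} {f g : R} (hf : f ∈ geIdeal x a)
    (hg : g ∈ geIdeal x b) : f * g ∈ geIdeal x (a + b) := by
  have : geIdeal x a * geIdeal x b ≤ geIdeal x (a + b) := by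
    rw [geIdeal, geIdeal, Ideal.span_mul_span', Ideal.span_le]
    rintro _ ⟨_, ⟨c, hc, rfl⟩, _, ⟨d, hd, rfl⟩, rfl⟩
    simp only [← mono_add]
    exact mono_mem_geIdeal (add_le_add hc hd)
  exact this (Ideal.mul_mem_mul hf hg)

lemma mul_mem_gtIdeal {a b : DegLex (Fin n →₀ ℕ)} {f g : R} (hf : f ∈ geIdeal x a)
    (hg : g ∈ gtIdeal x b) : f * g ∈ gtIdeal x (a + b) := by
  have : geIdeal x a * gtIdeal x b ≤ gtIdeal x (a + b) := by
    rw [geIdeal, gtIdeal, Ideal.span_mul_span', Ideal.span_le]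
    rintro _ ⟨_, ⟨c, hc, rfl⟩, _, ⟨d, hd, rfl⟩, rfl⟩
    simp only [← mono_add]
    exact mono_mem_gtIdeal (add_lt_add_of_le_of_lt hc hd)
  exact this (Ideal.mul_mem_mul hf hg)

lemma exists_sub_mem_gtIdeal {a : DegLex (Fin n →₀ ℕ)} {f : R} (hf : f ∈ geIdeal x a) :
    ∃ c, f - c * mono x a ∈ gtIdeal x a := by
  rw [geIdeal, ← Set.Ioi_insert, Set.image_insert_eq, Ideal.span_insert,
    Submodule.mem_sup] at hf
  obtain ⟨y, hy, z, hz, rfl⟩ := hf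
  obtain ⟨c, rfl⟩ := Ideal.mem_span_singleton'.mp hy
  exact ⟨c, by rwa [add_sub_cancel_left]⟩

lemma pow_le_gtIdeal {a : DegLex (Fin n →₀ ℕ)} {d : ℕ} (h : (ofDegLex a).degree < d) :
    Ideal.span (Set.range x) ^ d ≤ gtIdeal x a := by
  intro f hf
  obtain ⟨F, hF, rfl⟩ := (Ideal.mem_span_pow_iff_exists_isHomogeneous x f).mp hf
  rw [MvPolynomial.eval_eq']
  refine Ideal.sum_mem _ fun b hb ↦ Ideal.mul_mem_left _ _ ?_
  refine mono_mem_gtIdeal (b := toDegLex b) (Finsupp.DegLex.lt_iff.mpr (.inl ?_))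
  have := hF (MvPolynomial.mem_support_iff.mp hb)
  have hw : b.degree = Finsupp.weight 1 b := by rw [Finsupp.degree_eq_weight_one]; rfl
  exact h.trans_eq (hw.trans this).symm

lemma mono_mem_pow (a : DegLex (Fin n →₀ ℕ)) :
    mono x a ∈ Ideal.span (Set.range x) ^ (ofDegLex a).degree := by
  rw [Ideal.mem_span_pow_iff_exists_isHomogeneous]
  exact ⟨_, MvPolynomial.isHomogeneous_monomial 1 rfl, (mono_eq_eval x _).symm⟩

lemma geIdeal_le_pow (a : DegLex (Fin n →₀ ℕ)) :
    geIdeal x a ≤ Ideal.span (Set.range x) ^ (ofDegLex a).degree := by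
  refine Ideal.span_le.mpr ?_
  rintro _ ⟨b, hb, rfl⟩
  exact Ideal.pow_le_pow_right (Finsupp.DegLex.monotone_degree hb) (mono_mem_pow b)

lemma finite_Iic_degLex (a : DegLex (Fin n →₀ ℕ)) : (Set.Iic a).Finite := by
  let e : Fin n →₀ ℕ := Finsupp.equivFunOnFinite.symm fun _ ↦ (ofDegLex a).degree
  refine (Set.finite_Iic e).subset (s := (ofDegLex ⁻¹' Set.Iic e)) ?_
  intro b hb i
  exact (Finsupp.le_degree i _).trans (Finsupp.DegLex.monotone_degree hb)

variable {σ : R →+* R}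

/-- The property is multiplicative in the monomial, the units multiplying, so it follows from the
case of the parameters. -/
lemma exists_map_mono_sub_mem
    (hσ : ∀ i, ∃ c, IsUnit c ∧ σ (x i) - c * x i ∈ gtIdeal x (toDegLex (Finsupp.single i 1)))
    (a : DegLex (Fin n →₀ ℕ)) :
    ∃ c, IsUnit c ∧ σ (mono x a) - c * mono x a ∈ gtIdeal x a := by
  have hmul {a b : DegLex (Fin n →₀ ℕ)}
      (ha : ∃ c, IsUnit c ∧ σ (mono x a) - c * mono x a ∈ gtIdeal x a)
      (hb : ∃ c, IsUnit c ∧ σ (mono x b) - c * mono x b ∈ gtIdeal x b) :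
      ∃ c, IsUnit c ∧ σ (mono x (a + b)) - c * mono x (a + b) ∈ gtIdeal x (a + b) := by
    obtain ⟨c, hc, hac⟩ := ha
    obtain ⟨d, hd, hbd⟩ := hb
    refine ⟨c * d, hc.mul hd, ?_⟩
    have hσa : σ (mono x a) ∈ geIdeal x a := by
      simpa using Ideal.add_mem _ (gtIdeal_le_geIdeal a hac)
        (Ideal.mul_mem_left _ c (mono_mem_geIdeal (le_refl a)))
    have h1 := mul_mem_gtIdeal hσa hbd
    have h2 := Ideal.mul_mem_left _ d (mul_mem_gtIdeal (mono_mem_geIdeal (le_refl b)) hac)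
    rw [add_comm b a] at h2
    rw [mono_add, map_mul]
    convert Ideal.add_mem _ h1 h2 using 1
    ring
  have hzero : ∃ c, IsUnit c ∧
      σ (mono x 0) - c * mono x 0 ∈ gtIdeal x 0 := ⟨1, isUnit_one, by simp [mono_zero]⟩
  have : ∀ b : Fin n →₀ ℕ, ∃ c, IsUnit c ∧
      σ (mono x (toDegLex b)) - c * mono x (toDegLex b) ∈ gtIdeal x (toDegLex b) := by
    intro b
    induction b using Finsupp.induction_linear with
    | zero => exact hzero
    | add f g hf hg => exact hmul hf hg
    | single i m =>
      induction m with
      | zero => rw [Finsupp.single_zero]; exact hzero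
      | succ m hm =>
        rw [Finsupp.single_add]
        have h1 := hσ i
        rw [← mono_single x i] at h1
        exact hmul hm h1
  exact this a

lemma map_mem_geIdeal
    (hσ : ∀ i, ∃ c, IsUnit c ∧ σ (x i) - c * x i ∈ gtIdeal x (toDegLex (Finsupp.single i 1)))
    {a : DegLex (Fin n →₀ ℕ)} {f : R} (hf : f ∈ geIdeal x a) : σ f ∈ geIdeal x a := by
  suffices geIdeal x a ≤ (geIdeal x a).comap σ from this hf
  refine Ideal.span_le.mpr ?_
  rintro _ ⟨b, hb, rfl⟩
  obtain ⟨c, -, hc⟩ := exists_map_mono_sub_mem hσ b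
  refine geIdeal_anti hb ?_
  simpa using Ideal.add_mem _ (gtIdeal_le_geIdeal b hc)
    (Ideal.mul_mem_left _ c (mono_mem_geIdeal (le_refl b)))

lemma map_mem_gtIdeal
    (hσ : ∀ i, ∃ c, IsUnit c ∧ σ (x i) - c * x i ∈ gtIdeal x (toDegLex (Finsupp.single i 1)))
    {a : DegLex (Fin n →₀ ℕ)} {f : R} (hf : f ∈ gtIdeal x a) : σ f ∈ gtIdeal x a := by
  suffices gtIdeal x a ≤ (gtIdeal x a).comap σ from this hf
  refine Ideal.span_le.mpr ?_
  rintro _ ⟨b, hb, rfl⟩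
  exact geIdeal_le_gtIdeal hb (map_mem_geIdeal hσ (mono_mem_geIdeal le_rfl))

/-- `f` has leading exponent `a` with respect to the system of parameters `x`. -/
def HasLead (x : Fin n → R) (f : R) (a : DegLex (Fin n →₀ ℕ)) : Prop :=
  f ∈ geIdeal x a ∧ f ∉ gtIdeal x a

lemma HasLead.ne_zero {f : R} {a : DegLex (Fin n →₀ ℕ)} (hf : HasLead x f a) : f ≠ 0 := by
  rintro rfl
  exact hf.2 (zero_mem _)

lemma HasLead.le_iff {f : R} {a b : DegLex (Fin n →₀ ℕ)} (ha : HasLead x f a) :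
    f ∈ geIdeal x b ↔ b ≤ a :=
  ⟨fun h ↦ not_lt.mp fun hab ↦ ha.2 (geIdeal_le_gtIdeal hab h), fun h ↦ geIdeal_anti h ha.1⟩

variable [IsLocalRing R]

/-- A leading coefficient in the maximal ideal would push its term into `gtIdeal x a`. -/
lemma HasLead.exists_isUnit (hx : Ideal.span (Set.range x) = maximalIdeal R) {f : R}
    {a : DegLex (Fin n →₀ ℕ)} (hf : HasLead x f a) :
    ∃ c, IsUnit c ∧ f - c * mono x a ∈ gtIdeal x a := by
  obtain ⟨c, hc⟩ := exists_sub_mem_gtIdeal hf.1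
  refine ⟨c, ?_, hc⟩
  by_contra h
  have hc0 : c ∈ gtIdeal x 0 := pow_le_gtIdeal (d := 1)
    (by simp [show ofDegLex (0 : DegLex (Fin n →₀ ℕ)) = 0 from rfl])
    (by rw [pow_one, hx]; exact (mem_maximalIdeal _).mpr h)
  have := mul_mem_gtIdeal (mono_mem_geIdeal (le_refl a)) hc0
  rw [add_zero, mul_comm] at this
  exact hf.2 (by simpa using Ideal.add_mem _ hc this)

variable [IsNoetherianRing R]


/-- Modulo order `d + 1`, an element of `gtIdeal x a` is the value of a form of degree `d` without
the monomial `a`. Were it `mono x a`, the difference of the two forms would have coefficient `1` at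
`a`, against quasi-regularity. -/
lemma mono_notMem_gtIdeal (hx : Ideal.span (Set.range x) = maximalIdeal R)
    (hn : (n : WithBot ℕ∞) ≤ ringKrullDim R) (a : DegLex (Fin n →₀ ℕ)) :
    mono x a ∉ gtIdeal x a := by
  let d := (ofDegLex a).degree
  have key : ∀ f ∈ gtIdeal x a, ∃ F : MvPolynomial (Fin n) R, F.IsHomogeneous d ∧
      F.coeff (ofDegLex a) = 0 ∧ f - MvPolynomial.eval x F ∈ maximalIdeal R ^ (d + 1) := by
    intro f hf
    induction hf using Submodule.span_induction with
    | mem f hf =>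
      obtain ⟨b, hb, rfl⟩ := hf
      obtain h | ⟨h, -⟩ := Finsupp.DegLex.lt_iff.mp hb
      · refine ⟨0, MvPolynomial.isHomogeneous_zero _ _ _, by simp, ?_⟩
        rw [map_zero, sub_zero, ← hx]
        exact Ideal.pow_le_pow_right h (mono_mem_pow b)
      · refine ⟨MvPolynomial.monomial (ofDegLex b) 1,
          MvPolynomial.isHomogeneous_monomial 1 h.symm, ?_, ?_⟩
        · classical
          rw [MvPolynomial.coeff_monomial, if_neg]
          exact fun h ↦ (Set.mem_Ioi.mp hb).ne' h
        · rw [← mono_eq_eval]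
          simp
    | zero => exact ⟨0, MvPolynomial.isHomogeneous_zero _ _ _, by simp, by simp⟩
    | add f g _ _ hf hg =>
      obtain ⟨F, hF, hF', hF''⟩ := hf
      obtain ⟨G, hG, hG', hG''⟩ := hg
      refine ⟨F + G, hF.add hG, by simp [hF', hG'], ?_⟩
      convert Ideal.add_mem _ hF'' hG'' using 1
      rw [map_add]; ring
    | smul c f _ hf =>
      obtain ⟨F, hF, hF', hF''⟩ := hf
      refine ⟨MvPolynomial.C c * F, ?_, by simp [hF'], ?_⟩
      · simpa using (MvPolynomial.isHomogeneous_C _ c).mul hF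
      · convert Ideal.mul_mem_left _ c hF'' using 1
        simp; ring
  intro h
  obtain ⟨F, hF, hF', hF''⟩ := key _ h
  rw [show mono x a = mono x (toDegLex (ofDegLex a)) from rfl, mono_eq_eval, ← map_sub] at hF''
  have := coeff_mem_maximalIdeal_of_eval_mem x hx hn
    ((MvPolynomial.isHomogeneous_monomial 1 rfl).sub hF) hF'' (ofDegLex a)
  rw [MvPolynomial.coeff_sub, hF', sub_zero, MvPolynomial.coeff_monomial, if_pos rfl] at this
  exact (Ideal.ne_top_iff_one _).mp (maximalIdeal.isMaximal R).ne_top this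

/-- The exponent is the least `a` with `f ∉ gtIdeal x a`, which exists by Krull's intersection
theorem. Initial segments are finite, so a nonzero `a` has an immediate predecessor `b`, and `f ∈
gtIdeal x b` gives `f ∈ geIdeal x a`. -/
lemma exists_hasLead (hx : Ideal.span (Set.range x) = maximalIdeal R) {f : R} (hf : f ≠ 0) :
    ∃ a, HasLead x f a := by
  have hne : {a | f ∉ gtIdeal x a}.Nonempty := by
    by_contra! h
    have h (a) : f ∈ gtIdeal x a := by
      by_contra ha
      exact Set.eq_empty_iff_forall_notMem.mp h a ha
    rcases n with _ | n
    -- Without parameters, `0` is the only exponent and `gtIdeal x 0` is the zero ideal.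
    · refine hf ?_
      have := h 0
      rwa [gtIdeal, show Set.Ioi (0 : DegLex (Fin 0 →₀ ℕ)) = ∅ from
        Set.eq_empty_of_forall_notMem fun b hb ↦ (Set.mem_Ioi.mp hb).ne (Subsingleton.elim (α := Fin 0 →₀ ℕ) _ _),
        Set.image_empty, Ideal.span_empty] at this
    · have hK := Ideal.iInf_pow_eq_bot_of_isLocalRing (maximalIdeal R)
        (maximalIdeal.isMaximal R).ne_top
      refine hf ((Submodule.mem_bot R).mp (hK ▸ (Submodule.mem_iInf _).mpr fun N ↦ ?_))
      have := geIdeal_le_pow _ (gtIdeal_le_geIdeal _ (h (toDegLex (Finsupp.single 0 N))))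
      rwa [hx, ofDegLex_toDegLex, Finsupp.degree_single] at this
  obtain ⟨a, ha, hmin⟩ := WellFounded.has_min
    (wellFounded_lt (α := DegLex (Fin n →₀ ℕ))) _ hne
  refine ⟨a, ?_, ha⟩
  obtain rfl | h0 := eq_or_ne a 0
  · rw [geIdeal_zero]; trivial
  · obtain ⟨b, hb, hbmax⟩ := Set.exists_max_image (Set.Iio a) id
      ((finite_Iic_degLex a).subset Set.Iio_subset_Iic_self) ⟨0, bot_lt_iff_ne_bot.mpr h0⟩
    have hfb : f ∈ gtIdeal x b := by
      by_contra h
      exact hmin b h hb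
    refine Ideal.span_mono (Set.image_mono fun c hc ↦ ?_) hfb
    by_contra hca
    exact (hbmax c (Set.mem_Iio.mpr (not_le.mp hca))).not_gt hc

lemma hasLead_of_sub_mem (hx : Ideal.span (Set.range x) = maximalIdeal R)
    (hn : (n : WithBot ℕ∞) ≤ ringKrullDim R) {f c : R} {a : DegLex (Fin n →₀ ℕ)} (hc : IsUnit c)
    (hf : f - c * mono x a ∈ gtIdeal x a) : HasLead x f a := by
  refine ⟨?_, fun h ↦ mono_notMem_gtIdeal hx hn a ?_⟩
  · simpa using Ideal.add_mem _ (gtIdeal_le_geIdeal a hf)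
      (Ideal.mul_mem_left _ c (mono_mem_geIdeal (le_refl a)))
  · have := Ideal.sub_mem _ h hf
    rwa [sub_sub_cancel, Ideal.unit_mul_mem_iff_mem _ hc] at this

lemma HasLead.mul (hx : Ideal.span (Set.range x) = maximalIdeal R)
    (hn : (n : WithBot ℕ∞) ≤ ringKrullDim R) {f g : R} {a b : DegLex (Fin n →₀ ℕ)}
    (hf : HasLead x f a) (hg : HasLead x g b) : HasLead x (f * g) (a + b) := by
  obtain ⟨c, hc, hfc⟩ := hf.exists_isUnit hx
  obtain ⟨d, hd, hgd⟩ := hg.exists_isUnit hx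
  refine hasLead_of_sub_mem hx hn (hc.mul hd) ?_
  have h1 := mul_mem_gtIdeal hf.1 hgd
  have h2 := Ideal.mul_mem_left _ d (mul_mem_gtIdeal (mono_mem_geIdeal (le_refl b)) hfc)
  rw [add_comm b a] at h2
  rw [mono_add]
  convert Ideal.add_mem _ h1 h2 using 1
  ring

lemma HasLead.map (hx : Ideal.span (Set.range x) = maximalIdeal R)
    (hn : (n : WithBot ℕ∞) ≤ ringKrullDim R)
    (hσ : ∀ i, ∃ c, IsUnit c ∧ σ (x i) - c * x i ∈ gtIdeal x (toDegLex (Finsupp.single i 1)))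
    {a : DegLex (Fin n →₀ ℕ)} {f : R} (hf : HasLead x f a) : HasLead x (σ f) a := by
  obtain ⟨c, hc, hfc⟩ := hf.exists_isUnit hx
  obtain ⟨d, hd, had⟩ := exists_map_mono_sub_mem hσ a
  refine hasLead_of_sub_mem hx hn ((hc.map σ).mul hd) ?_
  have h1 := map_mem_gtIdeal hσ hfc
  rw [map_sub, map_mul] at h1
  convert Ideal.add_mem _ h1 (Ideal.mul_mem_left _ (σ c) had) using 1
  ring

end MonomialFiltration

/-! ### Parameters adapted to a commuting group of automorphisms. -/

lemma ker_eq_maximalIdeal_of_surjective {R k : Type*} [CommRing R] [IsLocalRing R] [Field k]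
    (ρ : R →+* k) (hρ : Function.Surjective ρ) : RingHom.ker ρ = maximalIdeal R :=
  eq_maximalIdeal (RingHom.ker_isMaximal_of_surjective ρ hρ)

/-- The retraction `ρ` identifies the residue field with `k`, so regularity can be read off from
dimensions over `k`. -/
lemma finrank_cotangent {k R : Type u} [Field k] [CommRing R] [IsLocalRing R]
    [IsNoetherianRing R] [Algebra k R] (ρ : R →ₐ[k] k) :
    FiniteDimensional k (maximalIdeal R).Cotangent ∧
      finrank k (maximalIdeal R).Cotangent =
        finrank (ResidueField R) (CotangentSpace R) := by
  have hρs : Function.Surjective (ρ : R →+* k) := fun c ↦ ⟨algebraMap k R c, by simp⟩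
  have hbij : Function.Bijective (algebraMap k (ResidueField R)) := by
    refine ⟨(algebraMap k (ResidueField R)).injective, fun y ↦ ?_⟩
    obtain ⟨r, rfl⟩ := residue_surjective y
    refine ⟨ρ r, ?_⟩
    rw [IsScalarTower.algebraMap_apply k R (ResidueField R), ← sub_eq_zero,
      ResidueField.algebraMap_eq, ← map_sub, residue_eq_zero_iff,
      ← ker_eq_maximalIdeal_of_surjective (ρ : R →+* k) hρs, RingHom.mem_ker]
    simp
  have e : k ≃ₗ[k] ResidueField R := LinearEquiv.ofBijective (Algebra.linearMap k _) hbij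
  have : FiniteDimensional k (ResidueField R) := Module.Finite.equiv e
  have : IsScalarTower k (ResidueField R) (CotangentSpace R) := by
    refine .of_algebraMap_smul fun c v ↦ ?_
    rw [IsScalarTower.algebraMap_apply k R (ResidueField R), algebraMap_smul]
    exact algebraMap_smul R c (v : (maximalIdeal R).Cotangent)
  refine ⟨Module.Finite.trans (ResidueField R) (CotangentSpace R), ?_⟩
  have := finrank_mul_finrank k (ResidueField R) (CotangentSpace R)
  rw [← e.finrank_eq, finrank_self, one_mul] at this
  exact this.symm

/-- A regular local ring with a commuting group of automorphisms has a regular system of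
parameters on which the group acts by triangular transformations modulo higher order terms. -/
lemma exists_triangular_parameters {k R : Type u} [Field k] [IsAlgClosed k] [CommRing R]
    [IsRegularLocalRing R] [Algebra k R] (ρ : R →ₐ[k] k) (S : Set (R →ₐ[k] R))
    (hρ : ∀ s ∈ S, ρ.comp s = ρ) (hS : ∀ s ∈ S, ∀ t ∈ S, s.comp t = t.comp s)
    (hinv : ∀ s ∈ S, ∃ t ∈ S, t.comp s = .id k R) :
    ∃ (n : ℕ) (x : Fin n → R), Ideal.span (Set.range x) = maximalIdeal R ∧
      (n : WithBot ℕ∞) ≤ ringKrullDim R ∧ ∀ s ∈ S, ∀ i, ∃ c, IsUnit c ∧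
        s (x i) - c * x i ∈ gtIdeal x (toDegLex (Finsupp.single i 1)) := by
  have hρs : Function.Surjective (ρ : R →+* k) := fun c ↦ ⟨algebraMap k R c, by simp⟩
  have hker := ker_eq_maximalIdeal_of_surjective (ρ : R →+* k) hρs
  let m := maximalIdeal R
  have hm (s : S) : m ≤ m.comap s.1 := by
    intro r hr
    rw [Ideal.mem_comap]
    change _ ∈ maximalIdeal R
    rw [← hker, RingHom.mem_ker]
    have : r ∈ RingHom.ker (ρ : R →+* k) := hker ▸ hr
    exact (DFunLike.congr_fun (hρ _ s.2) r).trans this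
  obtain ⟨hfin, hrank⟩ := finrank_cotangent ρ
  obtain ⟨b, hb, hbS⟩ := exists_triangular_spanning (k := k) (V := m.Cotangent)
    (Set.range fun s : S ↦ Ideal.mapCotangent m m s.1 (hm s)) (by
      rintro _ ⟨s, rfl⟩ _ ⟨t, rfl⟩
      refine LinearMap.ext fun v ↦ ?_
      obtain ⟨v, rfl⟩ := m.toCotangent_surjective v
      exact congrArg m.toCotangent (Subtype.ext (DFunLike.congr_fun (hS _ s.2 _ t.2) v.1))) (by
      rintro _ ⟨s, rfl⟩
      obtain ⟨t, ht, hts⟩ := hinv _ s.2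
      refine ⟨_, ⟨⟨t, ht⟩, rfl⟩, LinearMap.ext fun v ↦ ?_⟩
      obtain ⟨v, rfl⟩ := m.toCotangent_surjective v
      exact congrArg m.toCotangent (Subtype.ext (DFunLike.congr_fun hts v.1))) rfl
  choose y hy using fun i ↦ m.toCotangent_surjective (b i)
  have hyspan : Ideal.span (Set.range fun i ↦ (y i : R)) = m := by
    have h1 : Submodule.span (ResidueField R) (m.toCotangent '' Set.range y) = ⊤ := by
      rw [← Set.range_comp, show m.toCotangent ∘ y = b from funext hy, eq_top_iff]
      intro v _
      have hv : v ∈ Submodule.span k (Set.range b) := hb ▸ Submodule.mem_top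
      induction hv using Submodule.span_induction with
      | mem v hv => exact Submodule.subset_span hv
      | zero => exact zero_mem _
      | add v w _ _ hv hw => exact add_mem (hv trivial) (hw trivial)
      | smul c v _ hv =>
        have := Submodule.smul_mem (Submodule.span (ResidueField R) (Set.range b))
          (residue R (algebraMap k R c)) (hv trivial)
        convert this using 1
        exact (algebraMap_smul R c v).symm
    have h2 := CotangentSpace.span_image_eq_top_iff.mp h1
    have h3 := congrArg (Submodule.map m.subtype) h2
    rw [Submodule.map_span, Submodule.map_subtype_top, ← Set.range_comp] at h3
    exact h3
  refine ⟨_, fun i ↦ y i, hyspan, ?_, fun s hs i ↦ ?_⟩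
  · rw [← IsRegularLocalRing.iff_finrank_cotangentSpace R |>.mp inferInstance]
    exact_mod_cast hrank.le
  · obtain ⟨c, hc0, hc⟩ := hbS _ ⟨⟨s, hs⟩, rfl⟩ i
    refine ⟨algebraMap k R c, (IsUnit.mk0 c hc0).map _, ?_⟩
    let w : m := ⟨s (y i) - algebraMap k R c * y i,
      sub_mem (hm ⟨s, hs⟩ (y i).2) (m.mul_mem_left _ (y i).2)⟩
    have hw : m.toCotangent w ∈ Submodule.span R (m.toCotangent '' (y '' Set.Iio i)) := by
      rw [← Set.image_comp, show m.toCotangent ∘ y = b from funext hy]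
      have := Submodule.span_le_restrictScalars k R _ hc
      rw [Submodule.restrictScalars_mem] at this
      convert this using 1
      rw [← hy, Ideal.mapCotangent_toCotangent, ← algebraMap_smul R c, ← map_smul, ← map_sub]
      rfl
    rw [← Submodule.map_span, Submodule.mem_map] at hw
    obtain ⟨w', hw', hww'⟩ := hw
    rw [Ideal.toCotangent_eq] at hww'
    have hw1 : (w' : R) ∈ Ideal.span ((fun i ↦ (y i : R)) '' Set.Iio i) := by
      have := Submodule.mem_map_of_mem (f := m.subtype) hw'
      rwa [Submodule.map_span, ← Set.image_comp] at this
    -- The order on exponents reverses indices: for `j < i` the exponent of `y j` exceeds that of `y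
    -- i`. This matches the direction of the triangular basis.
    have h1 : Ideal.span ((fun i ↦ (y i : R)) '' Set.Iio i) ≤
        gtIdeal (fun i ↦ (y i : R)) (toDegLex (Finsupp.single i 1)) := by
      refine Ideal.span_le.mpr ?_
      rintro _ ⟨j, hj, rfl⟩
      have := mono_mem_gtIdeal (x := fun i ↦ (y i : R)) (Finsupp.DegLex.single_lt_iff.mpr hj)
      rwa [mono_single] at this
    have h2 := pow_le_gtIdeal (x := fun i ↦ (y i : R))
      (a := toDegLex (Finsupp.single i 1)) (d := 2) (by simp)
    rw [hyspan] at h2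
    have := sub_mem (h1 hw1) (h2 hww')
    rwa [sub_sub_cancel] at this

/-! ### The monomial valuation ring and its invariance. -/

section MonomialValuation

variable {R : Type u} [CommRing R] [IsLocalRing R] [IsNoetherianRing R]
  (K : Type u) [Field K] [Algebra R K] [IsFractionRing R K] {n : ℕ} {x : Fin n → R}

/-- The valuation ring of the monomial valuation attached to a regular system of parameters and
the graded lexicographic order. -/
def monomialValuationSubring [IsDomain R] (hx : Ideal.span (Set.range x) = maximalIdeal R)
    (hn : (n : WithBot ℕ∞) ≤ ringKrullDim R) : ValuationSubring K where
  carrier := {u | ∃ f g b, HasLead x g b ∧ f ∈ geIdeal x b ∧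
    u * algebraMap R K g = algebraMap R K f}
  one_mem' := by
    obtain ⟨b, hb⟩ := exists_hasLead hx (one_ne_zero (α := R))
    exact ⟨1, 1, b, hb, hb.1, one_mul _⟩
  zero_mem' := by
    obtain ⟨b, hb⟩ := exists_hasLead hx (one_ne_zero (α := R))
    exact ⟨0, 1, b, hb, zero_mem _, by simp⟩
  mul_mem' := by
    rintro u v ⟨f, g, b, hg, hf, hu⟩ ⟨f', g', b', hg', hf', hv⟩
    refine ⟨f * f', g * g', _, hg.mul hx hn hg', mul_mem_geIdeal hf hf', ?_⟩
    rw [map_mul, map_mul, ← hu, ← hv]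
    ring
  add_mem' := by
    rintro u v ⟨f, g, b, hg, hf, hu⟩ ⟨f', g', b', hg', hf', hv⟩
    refine ⟨f * g' + g * f', g * g', _, hg.mul hx hn hg',
      add_mem (mul_mem_geIdeal hf hg'.1) (mul_mem_geIdeal hg.1 hf'), ?_⟩
    rw [map_add, map_mul, map_mul, map_mul, ← hu, ← hv]
    ring
  neg_mem' := by
    rintro u ⟨f, g, b, hg, hf, hu⟩
    exact ⟨-f, g, b, hg, neg_mem hf, by rw [neg_mul, hu, map_neg]⟩
  mem_or_inv_mem' := by
    intro u
    obtain ⟨f, g, hg, rfl⟩ := IsFractionRing.div_surjective (A := R) u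
    have hg0 := nonZeroDivisors.ne_zero hg
    have hg1 : algebraMap R K g ≠ 0 := by simpa using hg0
    obtain ⟨b, hgb⟩ := exists_hasLead hx hg0
    obtain rfl | hf0 := eq_or_ne f 0
    · exact .inl ⟨0, g, b, hgb, zero_mem _, by simp⟩
    have hf1 : algebraMap R K f ≠ 0 := by simpa using hf0
    obtain ⟨a, hfa⟩ := exists_hasLead hx hf0
    obtain h | h := le_total b a
    · exact .inl ⟨f, g, b, hgb, hfa.le_iff.mpr h, div_mul_cancel₀ _ hg1⟩
    · exact .inr ⟨g, f, a, hfa, hgb.le_iff.mpr h, by rw [inv_div, div_mul_cancel₀ _ hf1]⟩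

variable {K} [IsDomain R] (hx : Ideal.span (Set.range x) = maximalIdeal R)
    (hn : (n : WithBot ℕ∞) ≤ ringKrullDim R)

lemma div_mem_monomialValuationSubring {f g : R} {a b : DegLex (Fin n →₀ ℕ)}
    (hf : HasLead x f a) (hg : HasLead x g b) :
    algebraMap R K f / algebraMap R K g ∈ monomialValuationSubring K hx hn ↔ b ≤ a := by
  have hg1 : algebraMap R K g ≠ 0 := by simpa using hg.ne_zero
  constructor
  · rintro ⟨f', g', b', hg', hf', h⟩
    rw [div_mul_eq_mul_div, div_eq_iff hg1, ← map_mul, ← map_mul] at h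
    have h := IsFractionRing.injective R K h
    have := mul_mem_geIdeal hf' hg.1
    rw [← h, (hf.mul hx hn hg').le_iff, add_comm] at this
    exact le_of_add_le_add_right this
  · exact fun h ↦ ⟨f, g, b, hg, hf.le_iff.mpr h, div_mul_cancel₀ _ hg1⟩

lemma algebraMap_mem_monomialValuationSubring (r : R) :
    algebraMap R K r ∈ monomialValuationSubring K hx hn :=
  have h0 : HasLead x (1 : R) 0 := hasLead_of_sub_mem hx hn isUnit_one (by simp [mono_zero])
  ⟨r, 1, 0, h0, by simp [geIdeal_zero], by simp⟩

/-- The disjunction says that `u - r` lies in the maximal ideal of the valuation ring, so `R`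
surjects onto the residue field. Here `r` is the ratio of the coefficients of `f` and `g` at `b`,
the latter being a unit. -/
lemma exists_sub_algebraMap_inv_notMem {u : K} (hu : u ∈ monomialValuationSubring K hx hn) :
    ∃ r : R, u - algebraMap R K r = 0 ∨
      (u - algebraMap R K r)⁻¹ ∉ monomialValuationSubring K hx hn := by
  obtain ⟨f, g, b, hg, hf, h⟩ := hu
  have hg1 : algebraMap R K g ≠ 0 := by simpa using hg.ne_zero
  obtain ⟨c, hc⟩ := exists_sub_mem_gtIdeal hf
  obtain ⟨_, ⟨d, rfl⟩, hd⟩ := hg.exists_isUnit hx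
  let r := c * ↑d⁻¹
  have hr : f - r * g ∈ gtIdeal x b := by
    convert Ideal.sub_mem _ hc (Ideal.mul_mem_left _ r hd) using 1
    linear_combination (-c * mono x b) * d.inv_mul
  have hur : u - algebraMap R K r = algebraMap R K (f - r * g) / algebraMap R K g := by
    rw [eq_div_iff hg1, sub_mul, h, map_sub, (algebraMap R K).map_mul r g]
  refine ⟨r, ?_⟩
  rw [hur]
  obtain h0 | h0 := eq_or_ne (f - r * g) 0
  · exact .inl (by simp [h0])
  · obtain ⟨a, ha⟩ := exists_hasLead hx h0
    refine .inr ?_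
    rw [inv_div, div_mem_monomialValuationSubring hx hn hg ha]
    intro hab
    exact ha.2 (Ideal.span_mono (Set.image_mono (Set.Ioi_subset_Ioi hab)) hr)

lemma map_mem_monomialValuationSubring {σ : R →+* R} {τ : K →+* K}
    (hτ : ∀ r, τ (algebraMap R K r) = algebraMap R K (σ r))
    (hσ : ∀ i, ∃ c, IsUnit c ∧ σ (x i) - c * x i ∈ gtIdeal x (toDegLex (Finsupp.single i 1)))
    (u : K) :
    τ u ∈ monomialValuationSubring K hx hn ↔ u ∈ monomialValuationSubring K hx hn := by
  obtain rfl | hu := eq_or_ne u 0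
  · simp
  obtain ⟨f, g, hg, rfl⟩ := IsFractionRing.div_surjective (A := R) u
  have hf0 : f ≠ 0 := by rintro rfl; simp at hu
  obtain ⟨a, ha⟩ := exists_hasLead hx hf0
  obtain ⟨b, hb⟩ := exists_hasLead hx (nonZeroDivisors.ne_zero hg)
  rw [map_div₀, hτ, hτ, div_mem_monomialValuationSubring hx hn ha hb,
    div_mem_monomialValuationSubring hx hn (ha.map hx hn hσ) (hb.map hx hn hσ)]

end MonomialValuation

/-- A regular local domain with residue field `k` that carries a commuting group of
`k`-automorphisms is dominated by an invariant valuation ring with residue field `k`. -/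
theorem exists_invariant_valuationSubring {k R : Type u} [Field k] [IsAlgClosed k] [CommRing R]
    [IsRegularLocalRing R] [IsDomain R] [Algebra k R] (K : Type u) [Field K] [Algebra R K]
    [IsFractionRing R K] (ρ : R →ₐ[k] k) (S : Set (R →ₐ[k] R))
    (hρ : ∀ s ∈ S, ρ.comp s = ρ) (hS : ∀ s ∈ S, ∀ t ∈ S, s.comp t = t.comp s)
    (hinv : ∀ s ∈ S, ∃ t ∈ S, t.comp s = .id k R) :
    ∃ (V : ValuationSubring K) (j : R →+* V) (π : V →+* k),
      (∀ r, (j r : K) = algebraMap R K r) ∧ π.comp j = ρ ∧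
      ∀ s ∈ S, ∃ (τ : V →+* V) (τ' : K →+* K), (∀ v, (τ v : K) = τ' v) ∧
        τ.comp j = j.comp s ∧ π.comp τ = π := by
  obtain ⟨n, x, hx, hn, hxS⟩ := exists_triangular_parameters ρ S hρ hS hinv
  have hρs : Function.Surjective (ρ : R →+* k) := fun c ↦ ⟨algebraMap k R c, by simp⟩
  have hker := ker_eq_maximalIdeal_of_surjective (ρ : R →+* k) hρs
  let V := monomialValuationSubring K hx hn
  let j : R →+* V := (algebraMap R K).codRestrict V.toSubring
    (algebraMap_mem_monomialValuationSubring hx hn)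
  have hmem {v : V} (hv : (v : K) = 0 ∨ (v : K)⁻¹ ∉ V) : v ∈ maximalIdeal V := by
    rw [mem_maximalIdeal, mem_nonunits_iff]
    intro hu
    obtain ⟨w, hw⟩ := isUnit_iff_exists_inv.mp hu
    have hw : (v : K) * w = 1 := congrArg Subtype.val hw
    obtain h | h := hv
    · simp [h] at hw
    · exact h (by rw [inv_eq_of_mul_eq_one_right hw]; exact w.2)
  have hmem' {v : V} (hv : v ∈ maximalIdeal V) : (v : K) = 0 ∨ (v : K)⁻¹ ∉ V := by
    by_contra! h
    refine (mem_maximalIdeal v).mp hv (isUnit_iff_exists_inv.mpr ⟨⟨_, h.2⟩, Subtype.ext ?_⟩)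
    exact mul_inv_cancel₀ h.1
  have hdec (v : V) : ∃ r : R, v - j r ∈ maximalIdeal V :=
    (exists_sub_algebraMap_inv_notMem hx hn v.2).imp fun r hr ↦ hmem hr
  let θ : R →+* ResidueField V := (residue V).comp j
  have hθ : Function.Surjective θ := by
    intro y
    obtain ⟨v, rfl⟩ := residue_surjective y
    obtain ⟨r, hr⟩ := hdec v
    refine ⟨r, ?_⟩
    rw [← residue_eq_zero_iff, map_sub, sub_eq_zero] at hr
    exact hr.symm
  -- Both maps are onto fields, so both kernels are the maximal ideal of `R`.
  have hkerθ : RingHom.ker θ = RingHom.ker (ρ : R →+* k) := by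
    rw [hker, ker_eq_maximalIdeal_of_surjective θ hθ]
  let π₀ : ResidueField V →+* k := RingHom.liftOfSurjective θ hθ ⟨(ρ : R →+* k), hkerθ.le⟩
  have hπ₀ (r) : π₀ (θ r) = ρ r := RingHom.liftOfRightInverse_comp_apply _ _ _ _ _
  refine ⟨V, j, π₀.comp (residue V), fun r ↦ rfl, RingHom.ext hπ₀, fun s hs ↦ ?_⟩
  have hinj : Function.Injective (s : R →+* R) := by
    obtain ⟨t, -, hts⟩ := hinv s hs
    exact Function.LeftInverse.injective (g := t) (DFunLike.congr_fun hts)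
  let τ' : K →+* K := IsFractionRing.map hinj
  have hτ' (r : R) : τ' (algebraMap R K r) = algebraMap R K (s r) :=
    IsLocalization.map_eq _ r
  have hτV (u : K) : τ' u ∈ V ↔ u ∈ V :=
    map_mem_monomialValuationSubring hx hn (σ := (s : R →+* R)) hτ' (hxS s hs) u
  let τ : V →+* V := (τ'.comp V.subtype).codRestrict V.toSubring fun v ↦ (hτV v).mpr v.2
  have hτj : τ.comp j = j.comp s := RingHom.ext fun r ↦ Subtype.ext (hτ' r)
  refine ⟨τ, τ', fun v ↦ rfl, hτj, RingHom.ext fun v ↦ ?_⟩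
  -- Since `v` agrees with `j r` in the residue field and `τ` preserves the maximal ideal,
  -- invariance of `π` reduces to that of `ρ`.
  obtain ⟨r, hr⟩ := hdec v
  have hτr : τ (v - j r) ∈ maximalIdeal V := by
    refine hmem ((hmem' hr).imp (fun h ↦ ?_) fun h ↦ ?_)
    · change τ' (v - j r : V) = 0
      rw [h, map_zero]
    · change (τ' (v - j r : V))⁻¹ ∉ V
      rwa [← map_inv₀, hτV]
  have h1 : residue V v = θ r := by
    rw [← residue_eq_zero_iff, map_sub, sub_eq_zero] at hr
    exact hr
  have h2 : residue V (τ v) = θ (s r) := by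
    rw [← residue_eq_zero_iff, map_sub, map_sub, sub_eq_zero] at hτr
    exact hτr.trans (congrArg (residue V) (DFunLike.congr_fun hτj r))
  change π₀ (residue V (τ v)) = π₀ (residue V v)
  rw [h1, h2, hπ₀, hπ₀]
  exact DFunLike.congr_fun (hρ s hs) r

/-! ### Translations by points of the group. -/

section Translation

variable {k : Type u} [Field k] {H X Z : Over (base k)} [GrpObj H] [ModObj H X] [ModObj H Z]

variable (X) in
/-- The translation of `X` by a point of the group. -/
noncomputable def translation (h : Point H) : X ⟶ X := (toUnit X ≫ h) • 𝟙 X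

lemma comp_translation (h : Point H) (x : Point X) :
    x ≫ translation X h = Point.act h x := by
  rw [translation, ModObj.comp_smul, Category.comp_id, ← Category.assoc,
    toUnit_unique (x ≫ toUnit X) (𝟙 _), Category.id_comp]
  rfl

lemma translation_comp (f : Z ⟶ X) [IsModHom H f] (h : Point H) :
    translation Z h ≫ f = f ≫ translation X h := by
  rw [translation, translation, IsModHom.map_smul, ModObj.comp_smul, Category.id_comp,
    Category.comp_id, ← Category.assoc, comp_toUnit]

lemma translation_comp_translation (h h' : Point H) :
    translation X h ≫ translation X h' = translation X (h' * h) := by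
  rw [translation, translation, translation, ModObj.comp_smul, Category.comp_id,
    ← Category.assoc, comp_toUnit, ← mul_smul, MonObj.comp_mul]

lemma translation_one : translation X (1 : Point H) = 𝟙 X := by
  rw [translation, MonObj.comp_one, one_smul]

instance (h : Point H) : IsIso (translation X h) :=
  ⟨translation X h⁻¹, by rw [translation_comp_translation, inv_mul_cancel, translation_one],
    by rw [translation_comp_translation, mul_inv_cancel, translation_one]⟩

lemma IsDiagonalizable.mul_comm (hH : IsDiagonalizable H) (h h' : Point H) : h * h' = h' * h := by
  obtain ⟨M, _, _, e, he⟩ := hH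
  rw [← cancel_mono e.hom, MonObj.mul_comp, MonObj.mul_comp, _root_.mul_comm]

end Translation

/-! ### Lifting generic points, and the valuative criterion. -/

lemma exists_specMap_fromSpecStalk {X : Scheme.{u}} {R : CommRingCat.{u}} [IsLocalRing R]
    (f : Spec R ⟶ X) {y : X} (h : f (closedPoint R) = y) :
    ∃ σ : X.presheaf.stalk y ⟶ R, Spec.map σ ≫ X.fromSpecStalk y = f := by
  subst h
  exact ⟨_, Scheme.Spec_stalkClosedPointTo_fromSpecStalk f⟩

/-- The image of `Spec K` in the spectrum of the stalk is the zero ideal, which specializes to the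
prime lying over the generic point of `X`. -/
lemma fromSpecStalk_fractionRing {X : Scheme.{u}} [IsIntegral X] (y : X) {K : Type u} [Field K]
    [Algebra (X.presheaf.stalk y) K] [IsFractionRing (X.presheaf.stalk y) K]
    (t : Spec (.of K)) :
    (Spec.map (CommRingCat.ofHom (algebraMap (X.presheaf.stalk y) K)) ≫ X.fromSpecStalk y) t =
      genericPoint X := by
  have hgen (w : X) : genericPoint X ⤳ w := genericPoint_specializes w
  obtain ⟨q, hq⟩ : genericPoint X ∈ Set.range (X.fromSpecStalk y) := by
    rw [Scheme.range_fromSpecStalk]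
    exact hgen y
  refine (Specializes.antisymm ?_ (hgen _)).eq
  rw [← hq, Scheme.Hom.comp_apply]
  refine Specializes.map ?_ (X.fromSpecStalk y).continuous
  refine (PrimeSpectrum.le_iff_specializes _ _).mp ?_
  have : (Spec.map (CommRingCat.ofHom (algebraMap (X.presheaf.stalk y) K)) t).asIdeal = ⊥ := by
    change Ideal.comap (algebraMap (X.presheaf.stalk y) K) t.asIdeal = ⊥
    rw [(eq_bot_or_eq_top t.asIdeal).resolve_right t.isPrime.ne_top,
      ← RingHom.ker_eq_comap_bot, RingHom.ker_eq_bot_iff_eq_zero]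
    exact fun r hr ↦ (map_eq_zero_iff _ (IsFractionRing.injective _ K)).mp hr
  exact (PrimeSpectrum.asIdeal_le_asIdeal _ _).mp (this.trans_le bot_le)

lemma exists_lift_of_isBirationalMorphism {Z X T : Scheme.{u}} [IsIntegral Z] [IsIntegral X]
    {f : Z ⟶ X} (hf : IsBirationalMorphism f) (i : T ⟶ X) (hi : ∀ t, i t = genericPoint X) :
    ∃ g : T ⟶ Z, g ≫ f = i ∧ ∀ t, g t = genericPoint Z := by
  obtain ⟨p, hp⟩ := hf
  have : Nonempty p.target := p.dense_target.nonempty.to_subtype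
  have : Nonempty p.source := p.dense_source.nonempty.to_subtype
  have hgX : p.target.ι (genericPoint p.target) = genericPoint X :=
    genericPoint_eq_of_isOpenImmersion _
  have hgZ : p.source.ι (genericPoint p.source) = genericPoint Z :=
    genericPoint_eq_of_isOpenImmersion _
  have hgp : p.iso.inv (genericPoint p.target) = genericPoint p.source :=
    genericPoint_eq_of_isOpenImmersion _
  let i' : T ⟶ p.target := IsOpenImmersion.lift p.target.ι i (by
    rintro _ ⟨t, rfl⟩
    exact ⟨_, hgX.trans (hi t).symm⟩)
  have hi' : i' ≫ p.target.ι = i := IsOpenImmersion.lift_fac _ _ _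
  have hi'g (t : T) : i' t = genericPoint p.target := by
    apply p.target.ι.injective
    rw [hgX, ← hi t, ← hi', Scheme.Hom.comp_apply]
  refine ⟨i' ≫ p.iso.inv ≫ p.source.ι, ?_, fun t ↦ ?_⟩
  · rw [Category.assoc, Category.assoc, ← hp, Iso.inv_hom_id_assoc, hi']
  · rw [Scheme.Hom.comp_apply, Scheme.Hom.comp_apply, hi'g, hgp, hgZ]

lemma eq_of_comp_eq_of_isBirationalMorphism {Z X T : Scheme.{u}} [IsIntegral Z] {f : Z ⟶ X}
    (hf : IsBirationalMorphism f) {a b : T ⟶ Z} (ha : ∀ t, a t = genericPoint Z)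
    (hb : ∀ t, b t = genericPoint Z) (hab : a ≫ f = b ≫ f) : a = b := by
  obtain ⟨p, hp⟩ := hf
  have : Nonempty p.source := p.dense_source.nonempty.to_subtype
  have hgZ : p.source.ι (genericPoint p.source) = genericPoint Z :=
    genericPoint_eq_of_isOpenImmersion _
  have hlift {c : T ⟶ Z} (hc : ∀ t, c t = genericPoint Z) :
      ∃ c' : T ⟶ p.source, c' ≫ p.source.ι = c :=
    ⟨IsOpenImmersion.lift p.source.ι c (by
      rintro _ ⟨t, rfl⟩
      exact ⟨_, hgZ.trans (hc t).symm⟩), IsOpenImmersion.lift_fac _ _ _⟩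
  obtain ⟨a', rfl⟩ := hlift ha
  obtain ⟨b', rfl⟩ := hlift hb
  rw [Category.assoc, Category.assoc, ← hp, ← Category.assoc, ← Category.assoc, cancel_mono,
    cancel_mono] at hab
  rw [hab]

/-- A fixed smooth point of the target of an equivariant birational morphism of complete varieties
lifts to a fixed point, if the points of the group commute with each other. -/
theorem exists_isFixedPoint_comp_eq {k : Type u} [Field k] [IsAlgClosed k] {H : Over (base k)}
    [GrpObj H] (hH : ∀ h h' : Point H, h * h' = h' * h) {Z X : Over (base k)} [ModObj H Z]
    [ModObj H X] (hZ : IsCompleteVariety Z) (hX : IsCompleteVariety X) (f : Z ⟶ X)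
    [IsModHom H f] (hf : IsBirationalMorphism f.left) (x : Point X)
    (hx_smooth : IsSmoothPoint x) (hx_fixed : IsFixedPoint H x) :
    ∃ z : Point Z, IsFixedPoint H z ∧ z ≫ f = x := by
  have := hX.integral
  have := hZ.integral
  have := hX.proper
  have := hZ.proper
  have hfproper : IsProper f.left := by
    have : IsProper (f.left ≫ X.hom) := by rw [Over.w]; infer_instance
    exact IsProper.of_comp f.left X.hom
  let p : Spec (.of k) ⟶ X.left := x.left
  let y := x.toSpace
  let R := X.left.presheaf.stalk y
  have : IsRegularLocalRing R := hx_smooth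
  let j : Spec R ⟶ X.left := X.left.fromSpecStalk y
  obtain ⟨ρ₀, hρ₀⟩ : ∃ ρ₀ : R ⟶ .of k, Spec.map ρ₀ ≫ j = p := exists_specMap_fromSpecStalk p rfl
  have hpX : p ≫ X.hom = 𝟙 _ := Over.w x
  -- the `k`-algebra structure of the local ring at `x`
  obtain ⟨c, hc⟩ : ∃ c : CommRingCat.of k ⟶ R, Spec.map c = j ≫ X.hom :=
    ⟨_, Spec.map_preimage _⟩
  let : Algebra k R := c.hom.toAlgebra
  let ρ : R →ₐ[k] k := { ρ₀.hom with
    commutes' := fun a ↦ by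
      have : c ≫ ρ₀ = 𝟙 _ := Spec.map_injective (by
        rw [Spec.map_comp, hc, ← Category.assoc, hρ₀, hpX, Spec.map_id])
      exact congrArg (fun g ↦ g.hom a) this }
  have hρ : CommRingCat.ofHom (ρ : R →+* k) = ρ₀ := rfl
  -- the action of the group on the local ring at `x`
  let S : Set (R →ₐ[k] R) := {s | ∃ h : Point H,
    Spec.map (CommRingCat.ofHom (s : R →+* R)) ≫ j = j ≫ (translation X h).left}
  have hS_exists (h : Point H) : ∃ s : R →ₐ[k] R,
      Spec.map (CommRingCat.ofHom (s : R →+* R)) ≫ j = j ≫ (translation X h).left := by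
    obtain ⟨σ, hσ⟩ := exists_specMap_fromSpecStalk (y := y) (j ≫ (translation X h).left) (by
      have h1 : j (closedPoint R) = y := Scheme.fromSpecStalk_closedPoint
      have h2 : p ≫ (translation X h).left = p :=
        congrArg Over.Hom.left ((comp_translation h x).trans (hx_fixed h))
      change (translation X h).left (j (closedPoint R)) = y
      rw [h1]
      exact congrArg (fun g : Spec (.of k) ⟶ X.left ↦ g (closedPoint k)) h2)
    refine ⟨{ σ.hom with commutes' := fun a ↦ ?_ }, hσ⟩
    have : c ≫ σ = c := Spec.map_injective (by
      rw [Spec.map_comp, hc, ← Category.assoc, hσ, Category.assoc, Over.w])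
    exact congrArg (fun g ↦ g.hom a) this
  have hS_ext {s t : R →ₐ[k] R} (hst : Spec.map (CommRingCat.ofHom (s : R →+* R)) ≫ j =
      Spec.map (CommRingCat.ofHom (t : R →+* R)) ≫ j) : s = t := by
    have := Spec.map_injective ((cancel_mono j).mp hst)
    exact AlgHom.ext fun r ↦ congrArg (fun g ↦ g.hom r) this
  have hS_comp {s t : R →ₐ[k] R} {h h' : Point H}
      (hs : Spec.map (CommRingCat.ofHom (s : R →+* R)) ≫ j = j ≫ (translation X h).left)
      (ht : Spec.map (CommRingCat.ofHom (t : R →+* R)) ≫ j = j ≫ (translation X h').left) :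
      Spec.map (CommRingCat.ofHom ((s.comp t : R →ₐ[k] R) : R →+* R)) ≫ j =
        j ≫ (translation X (h' * h)).left := by
    -- `Spec` is contravariant, so the order of the group elements is reversed.
    have : CommRingCat.ofHom ((s.comp t : R →ₐ[k] R) : R →+* R) =
      CommRingCat.ofHom (t : R →+* R) ≫ CommRingCat.ofHom (s : R →+* R) := rfl
    rw [this, Spec.map_comp, Category.assoc, ht, ← Category.assoc, hs, Category.assoc,
      ← Over.comp_left, translation_comp_translation]
  let K := FractionRing R
  obtain ⟨V, jV, π, hjV, hπ, hV⟩ := exists_invariant_valuationSubring K ρ S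
    (by
      rintro s ⟨h, hs⟩
      have h2 : p ≫ (translation X h).left = p :=
        congrArg Over.Hom.left ((comp_translation h x).trans (hx_fixed h))
      have : CommRingCat.ofHom (s : R →+* R) ≫ ρ₀ = ρ₀ := Spec.map_injective (by
        rw [← cancel_mono j, Spec.map_comp, Category.assoc, hs, ← Category.assoc, hρ₀, h2])
      exact AlgHom.ext fun r ↦ congrArg (fun g ↦ g.hom r) this)
    (by
      rintro s ⟨h, hs⟩ t ⟨h', ht⟩
      apply hS_ext
      rw [hS_comp hs ht, hS_comp ht hs, hH])
    (by
      rintro s ⟨h, hs⟩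
      obtain ⟨t, ht⟩ := hS_exists h⁻¹
      refine ⟨t, ⟨_, ht⟩, hS_ext ?_⟩
      rw [hS_comp ht hs, mul_inv_cancel, translation_one]
      exact (Category.comp_id j).trans ((congrArg (· ≫ j) (Spec.map_id R)).trans
        (Category.id_comp j)).symm)
  -- the lift of the generic point
  let ηX : Spec (.of K) ⟶ X.left := Spec.map (CommRingCat.ofHom (algebraMap R K)) ≫ j
  obtain ⟨g, hg, hgZ⟩ := exists_lift_of_isBirationalMorphism hf ηX (fromSpecStalk_fractionRing y)
  let a : Spec (.of K) ⟶ Spec (.of V) := Spec.map (CommRingCat.ofHom (algebraMap V K))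
  let b : Spec (.of V) ⟶ X.left := Spec.map (CommRingCat.ofHom jV) ≫ j
  have hab : a ≫ b = ηX := by
    rw [← Category.assoc, ← Spec.map_comp, ← CommRingCat.ofHom_comp]
    congr 3
    exact RingHom.ext hjV
  have hval : ValuativeCriterion f.left := by
    have := IsProper.eq_valuativeCriterion ▸ hfproper
    exact this.1.1.1
  obtain ⟨l, hl₁, hl₂⟩ : ∃ l : Spec (.of V) ⟶ Z.left, a ≫ l = g ∧ l ≫ f.left = b := by
    obtain ⟨l, hl₁, hl₂⟩ := (hval.existence
      { R := V, K := K, i₁ := g, i₂ := b, commSq := ⟨hg.trans hab.symm⟩ }).exists_lift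
    exact ⟨l, hl₁, hl₂⟩
  have hl_unique {l₁ l₂ : Spec (.of V) ⟶ Z.left} (h₁ : a ≫ l₁ = a ≫ l₂)
      (h₂ : l₁ ≫ f.left = l₂ ≫ f.left) : l₁ = l₂ := by
    let Q : ValuativeCommSq f.left :=
      { R := V, K := K, i₁ := a ≫ l₁, i₂ := l₁ ≫ f.left, commSq := ⟨Category.assoc _ _ _⟩ }
    have := (hval.uniqueness Q).elim ⟨l₁, rfl, rfl⟩ ⟨l₂, h₁.symm, h₂.symm⟩
    exact congrArg CommSq.LiftStruct.l this
  have hπρ : Spec.map (CommRingCat.ofHom π) ≫ b = p := by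
    rw [← hρ₀, ← Category.assoc, ← Spec.map_comp, ← CommRingCat.ofHom_comp, hπ, hρ]
  let z : Point Z := Over.homMk (Spec.map (CommRingCat.ofHom π) ≫ l) (by
    rw [← Over.w f, Category.assoc, reassoc_of% hl₂, ← Category.assoc, hπρ]
    exact hpX)
  refine ⟨z, fun h ↦ ?_, ?_⟩
  · rw [← comp_translation]
    obtain ⟨s, hs⟩ := hS_exists h
    obtain ⟨τ, τ', hτ, hτj, hπτ⟩ := hV s ⟨h, hs⟩
    have hτb : Spec.map (CommRingCat.ofHom τ) ≫ b = b ≫ (translation X h).left := by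
      rw [← Category.assoc, ← Spec.map_comp, ← CommRingCat.ofHom_comp, hτj,
        CommRingCat.ofHom_comp, Spec.map_comp, Category.assoc, hs, Category.assoc]
    have hτa : a ≫ Spec.map (CommRingCat.ofHom τ) = Spec.map (CommRingCat.ofHom τ') ≫ a := by
      rw [← Spec.map_comp, ← Spec.map_comp, ← CommRingCat.ofHom_comp, ← CommRingCat.ofHom_comp]
      congr 2
      exact RingHom.ext hτ
    have hequiv : (translation Z h).left ≫ f.left = f.left ≫ (translation X h).left := by
      rw [← Over.comp_left, translation_comp, Over.comp_left]
    have hl : l ≫ (translation Z h).left = Spec.map (CommRingCat.ofHom τ) ≫ l := by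
      have h₂ : (l ≫ (translation Z h).left) ≫ f.left =
          (Spec.map (CommRingCat.ofHom τ) ≫ l) ≫ f.left := by
        rw [Category.assoc, Category.assoc, hequiv, hl₂, reassoc_of% hl₂, hτb]
      -- Both lifts send `Spec K` to the generic point of `Z`, where `f` is a monomorphism, so
      -- agreement over `X` suffices.
      refine hl_unique (eq_of_comp_eq_of_isBirationalMorphism hf (fun t ↦ ?_) (fun t ↦ ?_) ?_) h₂
      · rw [reassoc_of% hl₁, Scheme.Hom.comp_apply, hgZ]
        have : IsIso (translation Z h).left :=
          inferInstanceAs (IsIso ((Over.forget _).map (translation Z h)))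
        exact genericPoint_eq_of_isOpenImmersion _
      · rw [reassoc_of% hτa, hl₁, Scheme.Hom.comp_apply, hgZ]
      · rw [Category.assoc, h₂, ← Category.assoc]
    ext1
    change (Spec.map (CommRingCat.ofHom π) ≫ l) ≫ (translation Z h).left =
      Spec.map (CommRingCat.ofHom π) ≫ l
    rw [Category.assoc, hl, ← Category.assoc, ← Spec.map_comp, ← CommRingCat.ofHom_comp, hπτ]
  · ext1
    change (Spec.map (CommRingCat.ofHom π) ≫ l) ≫ f.left = p
    rw [Category.assoc, hl₂, hπρ]

end EquivariantVariety

theorem proposition6p2 {k : Type u} [Field k] [IsAlgClosed k] [CharZero k]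
    (H : Over (EquivariantVariety.base k)) [GrpObj H]
    (hH : EquivariantVariety.IsDiagonalizable H)
    (Z X : Over (EquivariantVariety.base k)) [ModObj H Z] [ModObj H X]
    (hZ : EquivariantVariety.IsCompleteVariety Z) (hX : EquivariantVariety.IsCompleteVariety X)
    (f : Z ⟶ X) [IsModHom H f] (hf : EquivariantVariety.IsBirationalMorphism f.left)
    (x : EquivariantVariety.Point X) (hx_smooth : EquivariantVariety.IsSmoothPoint x)
    (hx_fixed : EquivariantVariety.IsFixedPoint H x) :
    ∃ z : EquivariantVariety.Point Z, EquivariantVariety.IsFixedPoint H z ∧ z ≫ f = x := by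
  exact EquivariantVariety.exists_isFixedPoint_comp_eq hH.mul_comm hZ hX f hf x hx_smooth hx_fixed
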